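/- Let $\mathbb K$ be a field, let $d\ge 0$ be an integer, and let $\mathcal A$ be a $\mathbb K$-algebra isomorphic to the algebra of $(d+1)\times(d+1)$ matrices over $\mathbb K$. An element of $\mathcal A$ is multiplicity-free if it has $d+1$ mutually distinct eigenvalues in $\mathbb K$; for an ordering $\theta_0,\dots,\theta_d$ of the eigenvalues of such an element $A$, the primitive idempotent of $A$ associated with $\theta_i$ is $E_i=\prod_{j\ne i}(A-\theta_jI)/(\theta_i-\theta_j)$. Let $\Phi=(A;\{E_i\}_{i=0}^d;A^*;\{E^*_i\}_{i=0}^d)$ be a Leonard system in $\mathcal A$: $A$ and $A^*$ are multiplicity-free elements of $\mathcal A$; $E_0,\dots,E_d$ (resp. $E^*_0,\dots,E^*_d$) is an ordering of the primitive idempotents of $A$ (resp. $A^*$); and for $0\le i,j\le d$ each of $E_iA^*E_j$ and $E^*_iAE^*_j$ is zero if $|i-j|>1$ and nonzero if $|i-j|=1$. Let $\theta_i$ (resp. $\theta^*_i$) be the eigenvalue of $A$ (resp. $A^*$) associated with $E_i$ (resp. $E^*_i$). Let $V$ be a simple $\mathcal A$-module and put $U_i=(E^*_0V+\cdots+E^*_iV)\cap(E_iV+\cdots+E_dV)$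 for $0\le i\le d$. For $1\le i\le d$ let $\varphi_i$ be the eigenvalue of $(A-\theta_{i-1}I)(A^*-\theta^*_iI)$ on $U_i$, that is, the scalar by which this element acts on $U_i$; the sequence $\varphi_1,\dots,\varphi_d$ is the first split sequence of $\Phi$. The second split sequence $\phi_1,\dots,\phi_d$ of $\Phi$ is the first split sequence of the Leonard system $\Phi^{\Downarrow}=(A;\{E_{d-i}\}_{i=0}^d;A^*;\{E^*_i\}_{i=0}^d)$. For $0\le i\le d$ define the polynomials $$\tau_i=\prod_{h=0}^{i-1}(\lambda-\theta_h),\quad \eta_i=\prod_{h=0}^{i-1}(\lambda-\theta_{d-h}),\quad \tau^*_i=\prod_{h=0}^{i-1}(\lambda-\theta^*_h),\quad \eta^*_i=\prod_{h=0}^{i-1}(\lambda-\theta^*_{d-h}).$$ Then the split sequences are well defined (for $1\le i\le d$ the space $U_i$ is nonzero and $(A-\theta_{i-1}I)(A^*-\theta^*_iI)$ acts on it as a unique scalar, and the same holds for $\Phi^{\Downarrow}$), the scalars $\eta^*_d(\theta^*_0)$, $\tau^*_d(\theta^*_d)$, $\eta_d(\theta_0)$, $\tau_d(\theta_d)$ are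 nonzero, and for $0\le i\le d$ $$\eta_i(A)E^*_0E_0=\frac{\phi_1\phi_2\cdots\phi_i}{\eta^*_d(\theta^*_0)}\,\eta^*_{d-i}(A^*)E_0,$$ $$\eta_i(A)E^*_dE_0=\frac{\varphi_d\varphi_{d-1}\cdots\varphi_{d-i+1}}{\tau^*_d(\theta^*_d)}\,\tau^*_{d-i}(A^*)E_0,$$ $$\tau_i(A)E^*_0E_d=\frac{\varphi_1\varphi_2\cdots\varphi_i}{\eta^*_d(\theta^*_0)}\,\eta^*_{d-i}(A^*)E_d,$$ $$\tau_i(A)E^*_dE_d=\frac{\phi_d\phi_{d-1}\cdots\phi_{d-i+1}}{\tau^*_d(\theta^*_d)}\,\tau^*_{d-i}(A^*)E_d,$$ $$\eta^*_i(A^*)E_0E^*_0=\frac{\phi_d\phi_{d-1}\cdots\phi_{d-i+1}}{\eta_d(\theta_0)}\,\eta_{d-i}(A)E^*_0,$$ $$\eta^*_i(A^*)E_dE^*_0=\frac{\varphi_d\varphi_{d-1}\cdots\varphi_{d-i+1}}{\tau_d(\theta_d)}\,\tau_{d-i}(A)E^*_0,$$ $$\tau^*_i(A^*)E_0E^*_d=\frac{\varphi_1\varphi_2\cdots\varphi_i}{\eta_d(\theta_0)}\,\eta_{d-i}(A)E^*_d,$$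 $$\tau^*_i(A^*)E_dE^*_d=\frac{\phi_1\phi_2\cdots\phi_i}{\tau_d(\theta_d)}\,\tau_{d-i}(A)E^*_d.$$ -/

import Mathlib

open Polynomial

noncomputable section

namespace Leonard

/-- The sequence `θ` is an ordering of the eigenvalues in `K` of `A`, these being `d + 1` in
number and mutually distinct. In particular `A` is multiplicity-free. -/
structure IsEigenvalueOrdering {K 𝒜 : Type*} [Field K] [Ring 𝒜] [Algebra K 𝒜] {d : ℕ}
    (A : 𝒜) (θ : Fin (d + 1) → K) : Prop where
  injective : Function.Injective θ
  range_eq : Set.range θ = spectrum K A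

/-- The primitive idempotent of `A` associated with `θ i`, namely the product over `j ≠ i` of
`(A - θ j) / (θ i - θ j)`. The Lagrange basis polynomial is by definition the product over
`j ≠ i` of `(X - θ j) / (θ i - θ j)`. -/
def primitiveIdempotent {K 𝒜 : Type*} [Field K] [Ring 𝒜] [Algebra K 𝒜] {d : ℕ}
    (A : 𝒜) (θ : Fin (d + 1) → K) (i : Fin (d + 1)) : 𝒜 :=
  aeval A (Lagrange.basis Finset.univ θ i)

/-- A Leonard system `(A; {E i}; A*; {E* i})` in the algebra `𝒜`. The eigenvalue sequences `θ`
and `θ*`, which are determined by the rest, are recorded as well. -/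
structure LeonardSystem (K 𝒜 : Type*) [Field K] [Ring 𝒜] [Algebra K 𝒜] (d : ℕ) where
  A : 𝒜
  E : Fin (d + 1) → 𝒜
  Astar : 𝒜
  Estar : Fin (d + 1) → 𝒜
  /-- `θ i` is the eigenvalue of `A` associated with `E i` -/
  θ : Fin (d + 1) → K
  /-- `θstar i` is the eigenvalue of `A*` associated with `E* i` -/
  θstar : Fin (d + 1) → K
  eigen : IsEigenvalueOrdering A θ
  eigen_star : IsEigenvalueOrdering Astar θstar
  E_eq : ∀ i, E i = primitiveIdempotent A θ i
  Estar_eq : ∀ i, Estar i = primitiveIdempotent Astar θstar i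
  E_Astar_E_eq_zero : ∀ i j : Fin (d + 1), 1 < |(i : ℤ) - (j : ℤ)| → E i * Astar * E j = 0
  E_Astar_E_ne_zero : ∀ i j : Fin (d + 1), |(i : ℤ) - (j : ℤ)| = 1 → E i * Astar * E j ≠ 0
  Estar_A_Estar_eq_zero : ∀ i j : Fin (d + 1),
    1 < |(i : ℤ) - (j : ℤ)| → Estar i * A * Estar j = 0
  Estar_A_Estar_ne_zero : ∀ i j : Fin (d + 1),
    |(i : ℤ) - (j : ℤ)| = 1 → Estar i * A * Estar j ≠ 0

theorem primitiveIdempotent_rev {K 𝒜 : Type*} [Field K] [Ring 𝒜] [Algebra K 𝒜] {d : ℕ}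
    (A : 𝒜) (θ : Fin (d + 1) → K) (i : Fin (d + 1)) :
    primitiveIdempotent A (fun j => θ j.rev) i = primitiveIdempotent A θ i.rev := by
  unfold primitiveIdempotent Lagrange.basis
  congr 1
  refine Finset.prod_bij (fun j _ => j.rev) ?_ ?_ ?_ ?_
  · intro j hj
    simpa using hj
  · intro a _ b _ h
    exact Fin.rev_injective h
  · intro b hb
    refine ⟨b.rev, ?_, by simp⟩
    simp only [Finset.mem_erase, Finset.mem_univ, and_true] at hb ⊢
    intro h
    exact hb (by rw [← h, Fin.rev_rev])
  · intro j _
    rfl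

theorem rev_sub_rev_abs {d : ℕ} (i j : Fin (d + 1)) :
    |((i.rev : Fin (d + 1)) : ℤ) - ((j.rev : Fin (d + 1)) : ℤ)| = |(i : ℤ) - (j : ℤ)| := by
  have hi : ((i.rev : Fin (d + 1)) : ℤ) = d - i := by
    have := i.is_lt
    rw [Fin.val_rev]; omega
  have hj : ((j.rev : Fin (d + 1)) : ℤ) = d - j := by
    have := j.is_lt
    rw [Fin.val_rev]; omega
  rw [hi, hj, abs_sub_comm (i : ℤ)]
  congr 1
  ring

namespace LeonardSystem

/-- The relative `(A; {E (d - i)}; A*; {E* i})` of the Leonard system `(A; {E i}; A*; {E* i})`. -/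
def Ddown {K 𝒜 : Type*} [Field K] [Ring 𝒜] [Algebra K 𝒜] {d : ℕ}
    (Φ : LeonardSystem K 𝒜 d) : LeonardSystem K 𝒜 d where
  A := Φ.A
  E := fun i => Φ.E i.rev
  Astar := Φ.Astar
  Estar := Φ.Estar
  θ := fun i => Φ.θ i.rev
  θstar := Φ.θstar
  eigen :=
    ⟨Φ.eigen.injective.comp Fin.rev_injective, by
      rw [← Φ.eigen.range_eq]
      exact Fin.rev_surjective.range_comp Φ.θ⟩
  eigen_star := Φ.eigen_star
  E_eq := fun i => by rw [primitiveIdempotent_rev, Φ.E_eq]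
  Estar_eq := Φ.Estar_eq
  E_Astar_E_eq_zero := fun i j h =>
    Φ.E_Astar_E_eq_zero i.rev j.rev (by rwa [rev_sub_rev_abs])
  E_Astar_E_ne_zero := fun i j h =>
    Φ.E_Astar_E_ne_zero i.rev j.rev (by rwa [rev_sub_rev_abs])
  Estar_A_Estar_eq_zero := Φ.Estar_A_Estar_eq_zero
  Estar_A_Estar_ne_zero := Φ.Estar_A_Estar_ne_zero

/-- The component `U i = (E* 0 V + ⋯ + E* i V) ∩ (E i V + ⋯ + E d V)` of the split
decomposition of the `𝒜`-module `V`. -/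
def splitSpace {K 𝒜 : Type*} [Field K] [Ring 𝒜] [Algebra K 𝒜] {d : ℕ}
    (Φ : LeonardSystem K 𝒜 d) (V : Type*) [AddCommGroup V] [Module K V] [Module 𝒜 V]
    [IsScalarTower K 𝒜 V] (i : Fin (d + 1)) : Submodule K V :=
  (⨆ j ≤ i, LinearMap.range (Algebra.lsmul K K V (Φ.Estar j))) ⊓
    (⨆ j ≥ i, LinearMap.range (Algebra.lsmul K K V (Φ.E j)))

/-- For `j : Fin d` and `i = j + 1`, so that `1 ≤ i ≤ d`: the space `U i` is nonzero and consists
of eigenvectors of `(A - θ (i - 1)) (A* - θ* i)` for the eigenvalue `c`. -/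
def IsSplitEigenvalue {K 𝒜 : Type*} [Field K] [Ring 𝒜] [Algebra K 𝒜] {d : ℕ}
    (Φ : LeonardSystem K 𝒜 d) (V : Type*) [AddCommGroup V] [Module K V] [Module 𝒜 V]
    [IsScalarTower K 𝒜 V] (j : Fin d) (c : K) : Prop :=
  Φ.splitSpace V j.succ ≠ ⊥ ∧
    Φ.splitSpace V j.succ ≤ Module.End.eigenspace
      (Algebra.lsmul K K V ((Φ.A - algebraMap K 𝒜 (Φ.θ j.castSucc)) *
        (Φ.Astar - algebraMap K 𝒜 (Φ.θstar j.succ)))) c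

/-- The first split sequence. The index `j : Fin d` stands for the term with number `j + 1`. -/
def firstSplit {K 𝒜 : Type*} [Field K] [Ring 𝒜] [Algebra K 𝒜] {d : ℕ}
    (Φ : LeonardSystem K 𝒜 d) (V : Type*) [AddCommGroup V] [Module K V] [Module 𝒜 V]
    [IsScalarTower K 𝒜 V] (j : Fin d) : K :=
  Classical.epsilon (Φ.IsSplitEigenvalue V j)

/-- The second split sequence, which is the first split sequence of the relative
`(A; {E (d - i)}; A*; {E* i})`. The index `j : Fin d` stands for the term with number `j + 1`. -/
def secondSplit {K 𝒜 : Type*} [Field K] [Ring 𝒜] [Algebra K 𝒜] {d : ℕ}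
    (Φ : LeonardSystem K 𝒜 d) (V : Type*) [AddCommGroup V] [Module K V] [Module 𝒜 V]
    [IsScalarTower K 𝒜 V] (j : Fin d) : K :=
  Φ.Ddown.firstSplit V j

end LeonardSystem

/-- The polynomial `(X - θ 0) (X - θ 1) ⋯ (X - θ (i - 1))`. -/
def tau {K : Type*} [Field K] {d : ℕ} (θ : Fin (d + 1) → K) (i : ℕ) : K[X] :=
  ∏ j ∈ Finset.univ.filter (fun j : Fin (d + 1) => (j : ℕ) < i), (X - C (θ j))

/-- The polynomial `(X - θ d) (X - θ (d - 1)) ⋯ (X - θ (d - i + 1))`. -/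
def eta {K : Type*} [Field K] {d : ℕ} (θ : Fin (d + 1) → K) (i : ℕ) : K[X] :=
  ∏ j ∈ Finset.univ.filter (fun j : Fin (d + 1) => d < (j : ℕ) + i), (X - C (θ j))

/-- The product `c_1 c_2 ⋯ c_i`, where `c_k` is the entry of `c` at index `k - 1`. -/
def prodFirst {K : Type*} [Field K] {d : ℕ} (c : Fin d → K) (i : ℕ) : K :=
  ∏ j ∈ Finset.univ.filter (fun j : Fin d => (j : ℕ) < i), c j

/-- The product `c_d c_{d-1} ⋯ c_{d-i+1}`, where `c_k` is the entry of `c` at index `k - 1`. -/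
def prodLast {K : Type*} [Field K] {d : ℕ} (c : Fin d → K) (i : ℕ) : K :=
  ∏ j ∈ Finset.univ.filter (fun j : Fin d => d ≤ (j : ℕ) + i), c j

end Leonard

end

/-! A simple module `V` is faithful of dimension `d + 1`, so the identities can be checked on
vectors. There `A` and `A*` have eigenbases `e` and `f`, and each is irreducible tridiagonal in the
eigenbasis of the other. The vectors whose `f`-coordinates vanish after `i` and whose
`e`-coordinates vanish before `i` form the split space `U_i`. It is a line, because a nonzero vector
in it has nonzero `i`-th coordinates in both bases. It is spanned by `η*_{d-i}(A*) e_d`, and it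
contains `τ_i(A) f_0`.

Now `A - θ_i` maps `U_i` into `U_{i+1}` and `A* - θ*_i` maps `U_i` into `U_{i-1}`. Peeling off
linear factors one at a time from `τ_i(A) η*_d(A*) e_d` and from `η*_i(A*) τ_d(A) f_0` therefore
releases one term of the first split sequence per step (`aeval_tau_aeval_eta`,
`aeval_eta_aeval_tau`). Since `E*_0` and `E_d` are scalar multiples of `η*_d(A*)` and `τ_d(A)`, this
gives the third and sixth identities.

The other six are these two applied to the relatives of `Φ` got by reversing the `E_i`, by
exchanging `A` with `A*`, or by both. This needs the first split sequence to be unchanged by the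
exchange (`isSplitScalar_swap`), which follows from a symmetric form for which both operators are
self-adjoint. -/

noncomputable section

namespace Leonard

/-! ### Supports of vectors under irreducible tridiagonal operators. -/

section LinearAlgebra

variable {K V : Type*} [Field K] [AddCommGroup V] [Module K V] {d : ℕ}

/-- The matrix of `T` with respect to the basis `b` is irreducible tridiagonal. -/
structure TridiagonalOn (T : Module.End K V) (b : Module.Basis (Fin (d + 1)) K V) : Prop where
  eq_zero : ∀ i j : Fin (d + 1), 1 < |(i : ℤ) - (j : ℤ)| → b.repr (T (b j)) i = 0
  ne_zero : ∀ i j : Fin (d + 1), |(i : ℤ) - (j : ℤ)| = 1 → b.repr (T (b j)) i ≠ 0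

theorem repr_reindex_rev (b : Module.Basis (Fin (d + 1)) K V) (x : V) (i : Fin (d + 1)) :
    (b.reindex Fin.revPerm).repr x i = b.repr x i.rev := by
  simp

theorem TridiagonalOn.rev {T : Module.End K V} {b : Module.Basis (Fin (d + 1)) K V}
    (h : TridiagonalOn T b) : TridiagonalOn T (b.reindex Fin.revPerm) where
  eq_zero i j hij := by
    rw [repr_reindex_rev, Module.Basis.reindex_apply]
    exact h.eq_zero _ _ (by rw [← rev_sub_rev_abs] at hij; exact hij)
  ne_zero i j hij := by
    rw [repr_reindex_rev, Module.Basis.reindex_apply]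
    exact h.ne_zero _ _ (by rw [← rev_sub_rev_abs] at hij; exact hij)

theorem repr_map_apply (T : Module.End K V) (b : Module.Basis (Fin (d + 1)) K V) (x : V)
    (i : Fin (d + 1)) : b.repr (T x) i = ∑ j, b.repr x j * b.repr (T (b j)) i := by
  conv_lhs => rw [← b.sum_repr x, map_sum, map_sum, Finsupp.finsetSum_apply]
  simp only [map_smul, Finsupp.smul_apply, smul_eq_mul]

/-- At coordinate `m + 1` only the neighbour `m` contributes, through a nonzero subdiagonal entry;
`c` multiplies a vanishing coordinate there. -/
theorem TridiagonalOn.raise_one {T : Module.End K V} {b : Module.Basis (Fin (d + 1)) K V}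
    (h : TridiagonalOn T b) (c : K) {x : V} {m : ℕ}
    (hx : ∀ k : Fin (d + 1), m < (k : ℕ) → b.repr x k = 0) :
    (∀ k : Fin (d + 1), m + 1 < (k : ℕ) → b.repr ((T - algebraMap K _ c) x) k = 0) ∧
      ∀ i j : Fin (d + 1), (i : ℕ) = m → (j : ℕ) = m + 1 → b.repr x i ≠ 0 →
        b.repr ((T - algebraMap K _ c) x) j ≠ 0 := by
  constructor
  · intro k hk
    simp only [LinearMap.sub_apply, Module.algebraMap_end_apply, map_sub, map_smul,
      Finsupp.sub_apply, Finsupp.smul_apply, repr_map_apply T b x k, hx k (by omega)]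
    rw [Finset.sum_eq_zero, smul_zero, sub_zero]
    intro j _
    by_cases hj : m < (j : ℕ)
    · rw [hx j hj, zero_mul]
    · rw [h.eq_zero k j, mul_zero]
      rw [lt_abs]; omega
  · intro i j hi hj hxi
    simp only [LinearMap.sub_apply, Module.algebraMap_end_apply, map_sub, map_smul,
      Finsupp.sub_apply, Finsupp.smul_apply, repr_map_apply T b x j, hx j (by omega)]
    rw [Finset.sum_eq_single i, smul_zero, sub_zero]
    · refine mul_ne_zero hxi (h.ne_zero j i ?_)
      rw [hi, hj]; simp
    · intro k _ hk
      have hk' : (k : ℕ) ≠ i := fun h => hk (Fin.ext h)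
      by_cases hkm : m < (k : ℕ)
      · rw [hx k hkm, zero_mul]
      · rw [h.eq_zero j k, mul_zero]
        rw [lt_abs]; omega
    · simp

theorem TridiagonalOn.raise {T : Module.End K V} {b : Module.Basis (Fin (d + 1)) K V}
    (h : TridiagonalOn T b) {ι : Type*} (s : Finset ι) (a : ι → K) {x : V} {m : ℕ}
    (hx : ∀ k : Fin (d + 1), m < (k : ℕ) → b.repr x k = 0) :
    (∀ k : Fin (d + 1), m + s.card < (k : ℕ) →
        b.repr (aeval T (∏ j ∈ s, (X - C (a j))) x) k = 0) ∧
      ∀ i j : Fin (d + 1), (i : ℕ) = m → (j : ℕ) = m + s.card → b.repr x i ≠ 0 →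
        b.repr (aeval T (∏ j ∈ s, (X - C (a j))) x) j ≠ 0 := by
  classical
  induction s using Finset.induction_on with
  | empty =>
    refine ⟨by simpa using hx, fun i j hi hj hxi => ?_⟩
    have : i = j := Fin.ext (by simp at hj; omega)
    simpa [← this] using hxi
  | insert l s hl ih =>
    rw [Finset.prod_insert hl, Finset.card_insert_of_notMem hl, map_mul, map_sub, aeval_X, aeval_C]
    have key := h.raise_one (a l) ih.1
    refine ⟨fun k hk => key.1 k (by omega), fun i j hi hj hxi => ?_⟩
    have hlt : m + s.card < d + 1 := by have := j.isLt; omega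
    exact key.2 ⟨m + s.card, hlt⟩ j rfl (by omega) (ih.2 i _ hi rfl hxi)

/-- Reversing the basis turns lowering into raising; `m ≤ d` makes the truncated `d - m` a genuine
reflection. -/
theorem TridiagonalOn.lower {T : Module.End K V} {b : Module.Basis (Fin (d + 1)) K V}
    (h : TridiagonalOn T b) {ι : Type*} (s : Finset ι) (a : ι → K) {x : V} {m : ℕ} (hm : m ≤ d)
    (hx : ∀ k : Fin (d + 1), (k : ℕ) < m → b.repr x k = 0) :
    (∀ k : Fin (d + 1), (k : ℕ) + s.card < m →
        b.repr (aeval T (∏ j ∈ s, (X - C (a j))) x) k = 0) ∧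
      ∀ i j : Fin (d + 1), (i : ℕ) = m → (j : ℕ) + s.card = m → b.repr x i ≠ 0 →
        b.repr (aeval T (∏ j ∈ s, (X - C (a j))) x) j ≠ 0 := by
  have key := h.rev.raise s a (x := x) (m := d - m) (fun k hk => by
    rw [repr_reindex_rev]
    exact hx _ (by rw [Fin.val_rev]; omega))
  constructor
  · intro k hk
    have := key.1 k.rev (by rw [Fin.val_rev]; omega)
    rwa [repr_reindex_rev, Fin.rev_rev] at this
  · intro i j hi hj hxi
    have := key.2 i.rev j.rev (by rw [Fin.val_rev]; omega)
      (by rw [Fin.val_rev]; omega) (by rwa [repr_reindex_rev, Fin.rev_rev])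
    rwa [repr_reindex_rev, Fin.rev_rev] at this

/-! ### The polynomials and the partial products of split sequences. -/

theorem eta_eq_tau_rev (θ : Fin (d + 1) → K) (i : ℕ) : eta θ i = tau (fun j => θ j.rev) i := by
  unfold eta tau
  refine Finset.prod_bij (fun j _ => j.rev) ?_ ?_ ?_ ?_
  · intro j hj
    simp only [Finset.mem_filter, Finset.mem_univ, true_and, Fin.val_rev] at hj ⊢
    omega
  · intro a _ b _ h
    exact Fin.rev_injective h
  · intro b hb
    refine ⟨b.rev, ?_, by simp⟩
    have := b.isLt
    simp only [Finset.mem_filter, Finset.mem_univ, true_and, Fin.val_rev] at hb ⊢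
    omega
  · intro j _
    simp

theorem tau_eq_eta_rev (θ : Fin (d + 1) → K) (i : ℕ) : tau θ i = eta (fun j => θ j.rev) i := by
  simp [eta_eq_tau_rev]

theorem tau_zero (θ : Fin (d + 1) → K) : tau θ 0 = 1 := by simp [tau]

theorem eta_zero (θ : Fin (d + 1) → K) : eta θ 0 = 1 := by simp [eta_eq_tau_rev, tau_zero]

theorem tau_succ (θ : Fin (d + 1) → K) (i : Fin (d + 1)) :
    tau θ (i + 1) = (X - C (θ i)) * tau θ i := by
  unfold tau
  have : Finset.univ.filter (fun j : Fin (d + 1) => (j : ℕ) < i + 1) =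
      insert i (Finset.univ.filter (fun j : Fin (d + 1) => (j : ℕ) < i)) := by
    ext j
    simp only [Finset.mem_filter, Finset.mem_univ, true_and, Finset.mem_insert, Fin.ext_iff]
    omega
  rw [this, Finset.prod_insert (by simp)]

/-- The index is `d - i` so that the new root is exactly `θ i`. -/
theorem eta_succ (θ : Fin (d + 1) → K) (i : Fin (d + 1)) :
    eta θ (d - i + 1) = (X - C (θ i)) * eta θ (d - i) := by
  have := tau_succ (fun j => θ j.rev) i.rev
  rw [eta_eq_tau_rev, eta_eq_tau_rev]
  have hv : ((i.rev : Fin (d + 1)) : ℕ) = d - i := by rw [Fin.val_rev]; omega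
  rwa [hv, Fin.rev_rev] at this

theorem prodFirst_succ (c : Fin d → K) (i : Fin d) :
    prodFirst c (i + 1) = c i * prodFirst c i := by
  unfold prodFirst
  have : Finset.univ.filter (fun j : Fin d => (j : ℕ) < i + 1) =
      insert i (Finset.univ.filter (fun j : Fin d => (j : ℕ) < i)) := by
    ext j
    simp only [Finset.mem_filter, Finset.mem_univ, true_and, Finset.mem_insert, Fin.ext_iff]
    omega
  rw [this, Finset.prod_insert (by simp)]

theorem prodLast_succ (c : Fin d → K) (i : Fin d) :
    prodLast c (d - (i + 1) + 1) = c i * prodLast c (d - (i + 1)) := by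
  unfold prodLast
  have : Finset.univ.filter (fun j : Fin d => d ≤ (j : ℕ) + (d - (i + 1) + 1)) =
      insert i (Finset.univ.filter (fun j : Fin d => d ≤ (j : ℕ) + (d - (i + 1)))) := by
    ext j
    simp only [Finset.mem_filter, Finset.mem_univ, true_and, Finset.mem_insert, Fin.ext_iff]
    omega
  rw [this, Finset.prod_insert (by simp; omega)]

theorem tau_eval_eq_zero (θ : Fin (d + 1) → K) {n : ℕ} {k : Fin (d + 1)} (hk : (k : ℕ) < n) :
    (tau θ n).eval (θ k) = 0 := by
  rw [tau, eval_prod]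
  exact Finset.prod_eq_zero (i := k) (by simpa using hk) (by simp)

theorem eta_eval_eq_zero (θ : Fin (d + 1) → K) {n : ℕ} {k : Fin (d + 1)} (hk : d < (k : ℕ) + n) :
    (eta θ n).eval (θ k) = 0 := by
  rw [eta, eval_prod]
  exact Finset.prod_eq_zero (i := k) (by simpa using hk) (by simp)

theorem tau_eval_last_ne_zero {θ : Fin (d + 1) → K} (hθ : Function.Injective θ) :
    (tau θ d).eval (θ (Fin.last d)) ≠ 0 := by
  rw [tau, eval_prod, Finset.prod_ne_zero_iff]
  intro j hj
  simp only [eval_sub, eval_X, eval_C]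
  refine sub_ne_zero.mpr (hθ.ne fun h => ?_)
  simp [← h] at hj

theorem eta_eval_zero_ne_zero {θ : Fin (d + 1) → K} (hθ : Function.Injective θ) :
    (eta θ d).eval (θ 0) ≠ 0 := by
  rw [eta_eq_tau_rev]
  simpa [Function.comp_def] using tau_eval_last_ne_zero (hθ.comp Fin.rev_injective)

theorem card_eta_index (i : ℕ) (hi : i ≤ d) :
    (Finset.univ.filter (fun j : Fin (d + 1) => d < (j : ℕ) + i)).card = i := by
  rw [← Finset.card_image_of_injective _ Fin.rev_injective]
  have : Finset.image Fin.rev (Finset.univ.filter (fun j : Fin (d + 1) => d < (j : ℕ) + i)) =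
      Finset.univ.filter (fun j : Fin (d + 1) => (j : ℕ) < i) := by
    ext j
    simp only [Finset.mem_image, Finset.mem_filter, Finset.mem_univ, true_and]
    constructor
    · rintro ⟨k, hk, rfl⟩
      rw [Fin.val_rev]; omega
    · intro hj
      exact ⟨j.rev, by rw [Fin.val_rev]; omega, Fin.rev_rev j⟩
  rw [this, Fin.card_filter_val_lt]
  omega

/-! ### Pairs of eigenbases and the split decomposition. -/

theorem repr_aeval {A : Module.End K V} {e : Module.Basis (Fin (d + 1)) K V}
    {θ : Fin (d + 1) → K} (h : ∀ i, A (e i) = θ i • e i) (p : K[X]) (x : V) (k : Fin (d + 1)) :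
    e.repr (aeval A p x) k = p.eval (θ k) * e.repr x k := by
  have hp : ∀ i, aeval A p (e i) = p.eval (θ i) • e i := fun i =>
    Module.End.aeval_apply_of_hasEigenvector
      (Module.End.hasEigenvector_iff.mpr
        ⟨Module.End.mem_eigenspace_iff.mpr (h i), e.ne_zero i⟩)
  rw [repr_map_apply, Finset.sum_eq_single k]
  · simp [hp, mul_comm]
  · intro j _ hj
    simp [hp, hj]
  · simp

theorem repr_sub_algebraMap {A : Module.End K V} {e : Module.Basis (Fin (d + 1)) K V}
    {θ : Fin (d + 1) → K} (h : ∀ i, A (e i) = θ i • e i) (c : K) (x : V) (k : Fin (d + 1)) :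
    e.repr ((A - algebraMap K _ c) x) k = (θ k - c) * e.repr x k := by
  have := repr_aeval h (X - C c) x k
  rwa [map_sub, aeval_X, aeval_C, eval_sub, eval_X, eval_C] at this

/-- `A` and `B` form a Leonard pair on `V`, with eigenbases `e` and `f`. -/
structure EigenbasisPair (A B : Module.End K V) (e f : Module.Basis (Fin (d + 1)) K V)
    (θ θ' : Fin (d + 1) → K) : Prop where
  injective : Function.Injective θ
  injective' : Function.Injective θ'
  map_e : ∀ i, A (e i) = θ i • e i
  map_f : ∀ i, B (f i) = θ' i • f i
  tridiagonal : TridiagonalOn B e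
  tridiagonal' : TridiagonalOn A f

/-- `x` lies in the `n`-th component of the split decomposition. -/
structure InSplit (e f : Module.Basis (Fin (d + 1)) K V) (n : ℕ) (x : V) : Prop where
  repr_f : ∀ k : Fin (d + 1), n < (k : ℕ) → f.repr x k = 0
  repr_e : ∀ k : Fin (d + 1), (k : ℕ) < n → e.repr x k = 0

/-- The scalar `c` is the term with number `j + 1` of the split sequence. -/
def IsSplitScalar (A B : Module.End K V) (e f : Module.Basis (Fin (d + 1)) K V)
    (θ θ' : Fin (d + 1) → K) (j : Fin d) (c : K) : Prop :=
  ∀ x, InSplit e f (j + 1) x →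
    (A - algebraMap K _ (θ j.castSucc)) ((B - algebraMap K _ (θ' j.succ)) x) = c • x

theorem InSplit.sub {e f : Module.Basis (Fin (d + 1)) K V} {n : ℕ} {x y : V}
    (hx : InSplit e f n x) (hy : InSplit e f n y) : InSplit e f n (x - y) :=
  ⟨fun k hk => by simp [hx.repr_f k hk, hy.repr_f k hk],
    fun k hk => by simp [hx.repr_e k hk, hy.repr_e k hk]⟩

theorem InSplit.smul {e f : Module.Basis (Fin (d + 1)) K V} {n : ℕ} {x : V}
    (hx : InSplit e f n x) (c : K) : InSplit e f n (c • x) :=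
  ⟨fun k hk => by simp [hx.repr_f k hk], fun k hk => by simp [hx.repr_e k hk]⟩

namespace EigenbasisPair

variable {A B : Module.End K V} {e f : Module.Basis (Fin (d + 1)) K V} {θ θ' : Fin (d + 1) → K}

theorem swap (h : EigenbasisPair A B e f θ θ') : EigenbasisPair B A f e θ' θ :=
  ⟨h.injective', h.injective, h.map_f, h.map_e, h.tridiagonal', h.tridiagonal⟩

/-- Only `f k` with `k < n` occur in `x`, so `tau θ' n` at `B` kills `x`. A first nonzero
`e`-coordinate would sit at some `m ≥ n`, and these `n` lowering factors would carry it to a nonzero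
coordinate at `m - n`. -/
theorem eq_zero_of_repr (h : EigenbasisPair A B e f θ θ') {n : ℕ} {x : V}
    (hf : ∀ k : Fin (d + 1), n ≤ (k : ℕ) → f.repr x k = 0)
    (he : ∀ k : Fin (d + 1), (k : ℕ) < n → e.repr x k = 0) : x = 0 := by
  have hkill : aeval B (tau θ' n) x = 0 := by
    refine f.ext_elem fun k => ?_
    rw [repr_aeval h.map_f]
    by_cases hk : (k : ℕ) < n
    · rw [tau_eval_eq_zero θ' hk]; simp
    · rw [hf k (by omega)]; simp
  have main : ∀ m : ℕ, ∀ k : Fin (d + 1), (k : ℕ) < m → e.repr x k = 0 := by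
    intro m
    induction m with
    | zero => intro k hk; omega
    | succ m ih =>
      intro k hk
      rcases Nat.lt_succ_iff_lt_or_eq.mp hk with hk | hk
      · exact ih k hk
      by_cases hmn : m < n
      · exact he k (by omega)
      by_contra hne
      have hkd := k.isLt
      have hcard : (Finset.univ.filter (fun j : Fin (d + 1) => (j : ℕ) < n)).card = n := by
        rw [Fin.card_filter_val_lt]; omega
      have hlow := (h.tridiagonal.lower
        (Finset.univ.filter (fun j : Fin (d + 1) => (j : ℕ) < n)) θ' (m := m) (by omega) ih).2
        k ⟨m - n, by omega⟩ hk (by rw [hcard]; simp; omega) hne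
      refine hlow ?_
      change e.repr (aeval B (tau θ' n) x) _ = 0
      rw [hkill]; simp
  exact e.ext_elem fun k => by simpa using main (d + 1) k k.isLt

/-- If this coordinate vanished, the two support conditions would no longer overlap and would force
`x = 0`. -/
theorem repr_f_ne_zero (h : EigenbasisPair A B e f θ θ') {x : V} (hx : x ≠ 0)
    {i : Fin (d + 1)} (hs : InSplit e f i x) : f.repr x i ≠ 0 := by
  intro h0
  refine hx (h.eq_zero_of_repr (n := i) (fun k hk => ?_) hs.repr_e)
  rcases hk.eq_or_lt with hk | hk
  · rwa [← Fin.ext hk]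
  · exact hs.repr_f k hk

theorem repr_e_ne_zero (h : EigenbasisPair A B e f θ θ') {x : V} (hx : x ≠ 0)
    {i : Fin (d + 1)} (hs : InSplit e f i x) : e.repr x i ≠ 0 := by
  intro h0
  refine hx (h.eq_zero_of_repr (n := i + 1) (fun k hk => hs.repr_f k (by omega)) fun k hk => ?_)
  rcases (Nat.lt_succ_iff.mp hk).eq_or_lt with hk | hk
  · rwa [Fin.ext hk]
  · exact hs.repr_e k hk

/-- Tridiagonality extends the `f`-support by one step, while subtracting `θ i` kills the lowest
`e`-coordinate. -/
theorem raise_inSplit (h : EigenbasisPair A B e f θ θ') (i : Fin (d + 1)) {x : V}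
    (hs : InSplit e f i x) : InSplit e f (i + 1) ((A - algebraMap K _ (θ i)) x) := by
  refine ⟨(h.tridiagonal'.raise_one (θ i) hs.repr_f).1, fun k hk => ?_⟩
  rw [repr_sub_algebraMap h.map_e]
  rcases (Nat.lt_succ_iff.mp hk).eq_or_lt with hk | hk
  · rw [Fin.ext hk, sub_self, zero_mul]
  · rw [hs.repr_e k hk, mul_zero]

theorem lower_inSplit (h : EigenbasisPair A B e f θ θ') {n : ℕ} {i : Fin (d + 1)}
    (hi : (i : ℕ) = n + 1) {x : V} (hs : InSplit e f i x) :
    InSplit e f n ((B - algebraMap K _ (θ' i)) x) := by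
  constructor
  · intro k hk
    rw [repr_sub_algebraMap h.map_f]
    rcases (show (i : ℕ) ≤ k by omega).eq_or_lt with hk | hk
    · rw [Fin.ext hk, sub_self, zero_mul]
    · rw [hs.repr_f k hk, mul_zero]
  · intro k hk
    have := (h.tridiagonal.lower {()} (fun _ => θ' i) (Nat.lt_succ_iff.mp i.isLt) hs.repr_e).1 k
      (by simp; omega)
    rwa [Finset.prod_singleton, map_sub, aeval_X, aeval_C] at this

/-- The roots remove every `f k` with `k > i`, and the `d - i` factors lower `e d` to a nonzero
coordinate at `i`. In particular the split space is nonzero. -/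
theorem aeval_eta_inSplit (h : EigenbasisPair A B e f θ θ') (i : Fin (d + 1)) :
    InSplit e f i (aeval B (eta θ' (d - i)) (e (Fin.last d))) ∧
      aeval B (eta θ' (d - i)) (e (Fin.last d)) ≠ 0 := by
  have hcard := card_eta_index (d := d) (d - i) (by omega)
  have hlow := h.tridiagonal.lower
    (Finset.univ.filter (fun j : Fin (d + 1) => d < (j : ℕ) + (d - i))) θ' (m := d) le_rfl
    (x := e (Fin.last d)) (fun k hk => by
      rw [e.repr_self, Finsupp.single_apply, if_neg]
      rintro rfl
      simp at hk)
  rw [hcard] at hlow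
  refine ⟨⟨fun k hk => ?_, fun k hk => hlow.1 k (by omega)⟩, fun h0 => ?_⟩
  · rw [repr_aeval h.map_f, eta_eval_eq_zero θ' (by omega), zero_mul]
  · refine hlow.2 (Fin.last d) i rfl (by omega) (by simp) ?_
    change e.repr (aeval B (eta θ' (d - i)) _) i = 0
    rw [h0]; simp

theorem aeval_tau_inSplit (h : EigenbasisPair A B e f θ θ') (i : Fin (d + 1)) :
    InSplit e f i (aeval A (tau θ i) (f 0)) := by
  have hcard : (Finset.univ.filter (fun j : Fin (d + 1) => (j : ℕ) < i)).card = i := by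
    rw [Fin.card_filter_val_lt]; omega
  have hr := h.tridiagonal'.raise
    (Finset.univ.filter (fun j : Fin (d + 1) => (j : ℕ) < i)) θ (m := 0)
    (x := f 0) (fun k hk => by
      rw [f.repr_self, Finsupp.single_apply, if_neg]
      rintro rfl
      simp at hk)
  rw [hcard] at hr
  refine ⟨fun k hk => hr.1 k (by omega), fun k hk => ?_⟩
  rw [repr_aeval h.map_e, tau_eval_eq_zero θ hk, zero_mul]

theorem exists_eq_smul (h : EigenbasisPair A B e f θ θ') {i : Fin (d + 1)} {x y : V}
    (hx : InSplit e f i x) (hy : InSplit e f i y) (hy0 : y ≠ 0) : ∃ c : K, x = c • y := by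
  -- Subtracting this multiple of `y` cancels the `i`-th `e`-coordinate, which detects nonzero
  -- vectors.
  refine ⟨e.repr x i / e.repr y i, ?_⟩
  by_contra hne
  refine h.repr_e_ne_zero (sub_ne_zero.mpr hne) (hx.sub (hy.smul _)) ?_
  have := h.repr_e_ne_zero hy0 hy
  simp [this]

theorem existsUnique_isSplitScalar (h : EigenbasisPair A B e f θ θ') (j : Fin d) :
    ∃! c : K, IsSplitScalar A B e f θ θ' j c := by
  obtain ⟨hw, hw0⟩ := h.aeval_eta_inSplit j.succ
  set w := aeval B (eta θ' (d - j.succ)) (e (Fin.last d))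
  have hmap : ∀ x, InSplit e f (j.succ : Fin (d + 1)) x → InSplit e f (j.succ : Fin (d + 1))
      ((A - algebraMap K _ (θ j.castSucc)) ((B - algebraMap K _ (θ' j.succ)) x)) := fun x hx =>
    h.raise_inSplit j.castSucc (h.lower_inSplit (n := (j.castSucc : Fin (d + 1))) (by simp) hx)
  obtain ⟨c, hc⟩ := h.exists_eq_smul (hmap w hw) hw hw0
  refine ⟨c, fun x hx => ?_, fun c' hc' => ?_⟩
  · obtain ⟨a, rfl⟩ := h.exists_eq_smul (i := j.succ) hx hw hw0
    rw [map_smul, map_smul, hc, smul_comm]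
  · exact smul_left_injective K hw0 ((hc' w hw).symm.trans hc)

/-- The next factor of `tau` meets the last factor split off from `eta`; together they form the
operator that acts on the next split space as a scalar. -/
theorem aeval_tau_aeval_eta (h : EigenbasisPair A B e f θ θ') {φ : Fin d → K}
    (hφ : ∀ j, IsSplitScalar A B e f θ θ' j (φ j)) {i : ℕ} (hi : i ≤ d) :
    aeval A (tau θ i) (aeval B (eta θ' d) (e (Fin.last d))) =
      prodFirst φ i • aeval B (eta θ' (d - i)) (e (Fin.last d)) := by
  induction i with
  | zero => simp [tau_zero, prodFirst]
  | succ i ih =>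
    have hid : i < d := hi
    have ht := tau_succ θ (Fin.castSucc ⟨i, hid⟩)
    have he := eta_succ θ' (Fin.succ ⟨i, hid⟩)
    have hp := prodFirst_succ φ ⟨i, hid⟩
    simp only [Fin.val_castSucc, Fin.val_succ] at ht he hp
    rw [show d - (i + 1) + 1 = d - i by omega] at he
    have hw := (h.aeval_eta_inSplit (Fin.succ ⟨i, hid⟩)).1
    have key := hφ ⟨i, hid⟩ _ hw
    rw [ht, hp, map_mul, Module.End.mul_apply, ih (by omega), map_smul, he, map_mul,
      Module.End.mul_apply, map_sub, map_sub, aeval_X, aeval_X, aeval_C, aeval_C]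
    simp only [Fin.val_succ] at key
    rw [key, smul_smul, mul_comm]

theorem lower_aeval_tau (h : EigenbasisPair A B e f θ θ') {j : Fin d} {c : K}
    (hc : IsSplitScalar A B e f θ θ' j c) :
    (B - algebraMap K _ (θ' j.succ)) (aeval A (tau θ (j + 1)) (f 0)) =
      c • aeval A (tau θ j) (f 0) := by
  have hv := h.aeval_tau_inSplit j.castSucc
  have hv' := h.aeval_tau_inSplit j.succ
  have ht := tau_succ θ j.castSucc
  simp only [Fin.val_castSucc, Fin.val_succ] at hv hv' ht
  have hstep : (A - algebraMap K _ (θ j.castSucc)) (aeval A (tau θ j) (f 0)) =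
      aeval A (tau θ (j + 1)) (f 0) := by
    rw [ht, map_mul, Module.End.mul_apply, map_sub, aeval_X, aeval_C]
  by_contra hne
  have hy : InSplit e f (j.castSucc : Fin (d + 1))
      ((B - algebraMap K _ (θ' j.succ)) (aeval A (tau θ (j + 1)) (f 0)) -
        c • aeval A (tau θ j) (f 0)) :=
    (h.lower_inSplit (by simp) (by simpa using hv')).sub (hv.smul c)
  have h0 := h.repr_f_ne_zero (sub_ne_zero.mpr hne) hy
  -- `A - θ_j` is injective on the `j`-th split space, since it carries a nonzero top `f`-coordinate
  -- one step up; yet it kills the difference, by the defining property of `c`.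
  refine (h.tridiagonal'.raise_one (θ j.castSucc) hy.repr_f).2 j.castSucc j.succ rfl
    (by simp) h0 ?_
  rw [map_sub, hc _ hv', map_smul, hstep, sub_self]
  simp

theorem aeval_eta_aeval_tau (h : EigenbasisPair A B e f θ θ') {φ : Fin d → K}
    (hφ : ∀ j, IsSplitScalar A B e f θ θ' j (φ j)) {i : ℕ} (hi : i ≤ d) :
    aeval B (eta θ' i) (aeval A (tau θ d) (f 0)) =
      prodLast φ i • aeval A (tau θ (d - i)) (f 0) := by
  induction i with
  | zero =>
    have : prodLast φ 0 = 1 := by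
      unfold prodLast
      rw [Finset.filter_false_of_mem, Finset.prod_empty]
      intro j _; have := j.isLt; omega
    simp [eta_zero, this]
  | succ i ih =>
    have hid : d - (i + 1) < d := by omega
    have he := eta_succ θ' (Fin.succ ⟨d - (i + 1), hid⟩)
    have hp := prodLast_succ φ ⟨d - (i + 1), hid⟩
    have key := h.lower_aeval_tau (hφ ⟨d - (i + 1), hid⟩)
    simp only [Fin.val_succ] at he hp key
    rw [show d - (d - (i + 1) + 1) = i by omega] at he hp
    rw [show d - (i + 1) + 1 = d - i by omega] at key
    rw [he, hp, map_mul, Module.End.mul_apply, ih (by omega), map_smul, map_sub, aeval_X, aeval_C,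
      key, smul_smul, mul_comm]

end EigenbasisPair

/-! ### The invariant bilinear form and the exchange of `A` with `A*`. -/

theorem TridiagonalOn.exists_symmetrizer {T : Module.End K V}
    {b : Module.Basis (Fin (d + 1)) K V} (h : TridiagonalOn T b) :
    ∃ κ : Fin (d + 1) → K, (∀ i, κ i ≠ 0) ∧
      ∀ i j, κ i * b.repr (T (b j)) i = κ j * b.repr (T (b i)) j := by
  -- The ratio `κ (m + 1) / κ m` forced by symmetry at the entries `(m, m + 1)` and `(m + 1, m)`;
  -- the value 1 out of range is a harmless nonzero filler.
  let r : ℕ → K := fun m => if hm : m + 1 < d + 1 then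
    b.repr (T (b ⟨m + 1, hm⟩)) ⟨m, by omega⟩ / b.repr (T (b ⟨m, by omega⟩)) ⟨m + 1, hm⟩ else 1
  let κ : ℕ → K := fun n => ∏ m ∈ Finset.range n, r m
  have hr : ∀ m, r m ≠ 0 := by
    intro m
    by_cases hm : m + 1 < d + 1
    · simp only [r, dif_pos hm]
      exact div_ne_zero (h.ne_zero _ _ (by simp)) (h.ne_zero _ _ (by simp))
    · simp only [r, dif_neg hm]
      exact one_ne_zero
  have hstep : ∀ i j : Fin (d + 1), (i : ℕ) + 1 = j →
      κ i * b.repr (T (b j)) i = κ j * b.repr (T (b i)) j := by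
    rintro ⟨i, hi⟩ ⟨j, hj⟩ hij
    obtain rfl : i + 1 = j := hij
    have hne := h.ne_zero ⟨i + 1, hj⟩ ⟨i, hi⟩ (by simp)
    simp only [κ, Finset.prod_range_succ, r, dif_pos hj]
    field_simp
  refine ⟨fun i => κ i, fun i => Finset.prod_ne_zero_iff.mpr fun m _ => hr m, fun i j => ?_⟩
  by_cases h1 : (i : ℕ) + 1 = j
  · exact hstep i j h1
  by_cases h2 : (j : ℕ) + 1 = i
  · exact (hstep j i h2).symm
  by_cases h3 : (i : ℕ) = j
  · rw [Fin.ext h3]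
  · rw [h.eq_zero i j (by rw [lt_abs]; omega), h.eq_zero j i (by rw [lt_abs]; omega),
      mul_zero, mul_zero]

theorem bilin_apply_eq_sum {β : LinearMap.BilinForm K V} {b : Module.Basis (Fin (d + 1)) K V}
    (hβ : ∀ i j, i ≠ j → β (b i) (b j) = 0) (x y : V) :
    β x y = ∑ k, b.repr x k * b.repr y k * β (b k) (b k) := by
  conv_lhs => rw [← b.sum_repr x, ← b.sum_repr y]
  simp only [map_sum, LinearMap.sum_apply, map_smul, LinearMap.smul_apply, smul_eq_mul]
  refine Finset.sum_congr rfl fun k _ => ?_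
  rw [Finset.sum_eq_single k]
  · ring
  · intro j _ hj
    rw [hβ _ _ hj]; ring
  · simp

namespace EigenbasisPair

variable {A B : Module.End K V} {e f : Module.Basis (Fin (d + 1)) K V} {θ θ' : Fin (d + 1) → K}

theorem rev (h : EigenbasisPair A B e f θ θ') :
    EigenbasisPair A B (e.reindex Fin.revPerm) f (fun j => θ j.rev) θ' :=
  ⟨h.injective.comp Fin.rev_injective, h.injective', fun i => by simp [h.map_e], h.map_f,
    h.tridiagonal.rev, h.tridiagonal'⟩

/-- A symmetric form for which both members of the pair are self-adjoint. -/
theorem exists_bilinForm (h : EigenbasisPair A B e f θ θ') :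
    ∃ β : LinearMap.BilinForm K V, (∀ i, β (f i) (f i) ≠ 0) ∧
      (∀ i j, i ≠ j → β (f i) (f j) = 0) ∧ (∀ i j, i ≠ j → β (e i) (e j) = 0) ∧
      (∀ x y, β (A x) y = β x (A y)) ∧ ∀ x y, β (B x) y = β x (B y) := by
  obtain ⟨κ, hκ, hsymm⟩ := h.tridiagonal'.exists_symmetrizer
  let β : LinearMap.BilinForm K V := Matrix.toBilin f (Matrix.diagonal κ)
  have hβ : ∀ i j, β (f i) (f j) = Matrix.diagonal κ i j := fun i j => by
    rw [← LinearMap.BilinForm.toMatrix_apply f β i j, LinearMap.BilinForm.toMatrix_toBilin]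
  have hβ0 : ∀ i j, i ≠ j → β (f i) (f j) = 0 := fun i j hij => by
    rw [hβ, Matrix.diagonal_apply_ne _ hij]
  have hA : ∀ x y, β (A x) y = β x (A y) := by
    have : β.compLeft A = β.compRight A := LinearMap.BilinForm.ext_basis f fun i j => by
      rw [LinearMap.BilinForm.compLeft_apply, LinearMap.BilinForm.compRight_apply,
        bilin_apply_eq_sum hβ0, bilin_apply_eq_sum hβ0, Finset.sum_eq_single j,
        Finset.sum_eq_single i]
      · simp only [f.repr_self, Finsupp.single_eq_same, hβ, Matrix.diagonal_apply_eq]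
        linear_combination hsymm j i
      · intro k _ hk
        simp [f.repr_self, hk.symm]
      · simp
      · intro k _ hk
        simp [f.repr_self, hk.symm]
      · simp
    exact fun x y => LinearMap.congr_fun (LinearMap.congr_fun this x) y
  have hB : ∀ x y, β (B x) y = β x (B y) := by
    have : β.compLeft B = β.compRight B := LinearMap.BilinForm.ext_basis f fun i j => by
      rw [LinearMap.BilinForm.compLeft_apply, LinearMap.BilinForm.compRight_apply, h.map_f,
        h.map_f, map_smul, map_smul, LinearMap.smul_apply]
      by_cases hij : i = j
      · rw [hij]
      · rw [hβ0 i j hij, smul_zero, smul_zero]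
    exact fun x y => LinearMap.congr_fun (LinearMap.congr_fun this x) y
  refine ⟨β, fun i => by rw [hβ, Matrix.diagonal_apply_eq]; exact hκ i, hβ0, fun i j hij => ?_,
    hA, hB⟩
  -- Eigenvectors of a self-adjoint operator for distinct eigenvalues are orthogonal.
  have := hA (e i) (e j)
  rw [h.map_e, h.map_e, map_smul, map_smul, LinearMap.smul_apply, smul_eq_mul, smul_eq_mul,
    ← sub_eq_zero, ← sub_mul] at this
  exact (mul_eq_zero.mp this).resolve_left (sub_ne_zero.mpr (h.injective.ne hij))

/-- Pair a vector `u` of the split space with a vector `v` of the split space of the exchanged pair.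
Moving operators across the form turns both scalars into the same multiple of `β u v`. -/
theorem isSplitScalar_swap (h : EigenbasisPair A B e f θ θ') {j : Fin d} {c : K}
    (hc : IsSplitScalar A B e f θ θ' j c) : IsSplitScalar B A f e θ' θ j c := by
  obtain ⟨c', hc', -⟩ := h.swap.existsUnique_isSplitScalar j
  suffices c = c' by rwa [this]
  obtain ⟨β, hβf, hf, he, hA, hB⟩ := h.exists_bilinForm
  obtain ⟨hu, hu0⟩ := h.aeval_eta_inSplit j.succ
  obtain ⟨hv, hv0⟩ := h.swap.aeval_eta_inSplit j.succ
  set u := aeval B (eta θ' (d - j.succ)) (e (Fin.last d))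
  set v := aeval A (eta θ (d - j.succ)) (f (Fin.last d))
  -- The `f`-supports of `u` and `v` meet only at index `j + 1`.
  have huv : β u v ≠ 0 := by
    rw [bilin_apply_eq_sum hf, Finset.sum_eq_single j.succ]
    · exact mul_ne_zero (mul_ne_zero (h.repr_f_ne_zero hu0 hu) (h.swap.repr_e_ne_zero hv0 hv))
        (hβf _)
    · intro k _ hk
      rcases lt_or_gt_of_ne (fun h' => hk (Fin.ext h') : (k : ℕ) ≠ (j.succ : Fin (d + 1)))
        with hlt | hlt
      · rw [hv.repr_e k hlt]; ring
      · rw [hu.repr_f k hlt]; ring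
    · simp
  have hz : InSplit f e (j.castSucc : Fin (d + 1)) ((A - algebraMap K _ (θ j.succ)) v) :=
    h.swap.lower_inSplit (by simp) hv
  -- Here the `e`-supports are disjoint; for `huy` below, the `f`-supports are.
  have huz : β u ((A - algebraMap K _ (θ j.succ)) v) = 0 := by
    rw [bilin_apply_eq_sum he]
    refine Finset.sum_eq_zero fun k _ => ?_
    by_cases hk : (k : ℕ) < (j.succ : Fin (d + 1))
    · rw [hu.repr_e k hk]; ring
    · rw [hz.repr_f k (by simp at hk ⊢; omega)]; ring
  have hy : InSplit f e ((j.succ : Fin (d + 1)) + 1) ((B - algebraMap K _ (θ' j.succ)) v) :=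
    h.swap.raise_inSplit j.succ hv
  have huy : β u ((B - algebraMap K _ (θ' j.succ)) v) = 0 := by
    rw [bilin_apply_eq_sum hf]
    refine Finset.sum_eq_zero fun k _ => ?_
    by_cases hk : ((j.succ : Fin (d + 1)) : ℕ) < k
    · rw [hu.repr_f k hk]; ring
    · rw [hy.repr_e k (by omega)]; ring
  have h1 : β ((A - algebraMap K _ (θ j.castSucc)) ((B - algebraMap K _ (θ' j.succ)) u)) v =
      c * β u v := by
    rw [hc u (by simpa using hu), map_smul, LinearMap.smul_apply, smul_eq_mul]
  have h2 : β u ((B - algebraMap K _ (θ' j.castSucc)) ((A - algebraMap K _ (θ j.succ)) v)) =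
      c' * β u v := by
    rw [hc' v (by simpa using hv), map_smul, smul_eq_mul]
  simp only [LinearMap.sub_apply, Module.algebraMap_end_apply, map_sub, map_smul,
    LinearMap.smul_apply, smul_eq_mul, hA, hB] at h1 h2 huz huy
  refine mul_right_cancel₀ huv ?_
  -- By `huz` and `huy`, both sides equal `β u (B (A v)) - θ_{j+1} θ'_{j+1} β u v`.
  linear_combination h2 - h1 + (θ' j.castSucc - θ' j.succ) * huz +
    (θ j.succ - θ j.castSucc) * huy

end EigenbasisPair

end LinearAlgebra

/-! ### Simple modules over a matrix algebra. -/

section MatrixAlgebra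

variable {K 𝒜 V : Type*} [Field K] [Ring 𝒜] [Algebra K 𝒜] {d : ℕ}

theorem lsmul_injective (g : 𝒜 ≃ₐ[K] Matrix (Fin (d + 1)) (Fin (d + 1)) K)
    [AddCommGroup V] [Module K V] [Module 𝒜 V] [IsScalarTower K 𝒜 V] [IsSimpleModule 𝒜 V] :
    Function.Injective (Algebra.lsmul K K V : 𝒜 →ₐ[K] Module.End K V) := by
  have : IsSimpleRing 𝒜 := IsSimpleRing.of_ringEquiv g.symm.toRingEquiv inferInstance
  have : Nontrivial V := IsSimpleModule.nontrivial 𝒜 V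
  exact (Algebra.lsmul K K V : 𝒜 →ₐ[K] Module.End K V).toRingHom.injective

/-- Bounds the dimension of `V` by `d + 1`: some diagonal matrix unit does not kill `v`, and the
matrix units of that column applied to `v` span. -/
theorem exists_span_range_eq_top (g : 𝒜 ≃ₐ[K] Matrix (Fin (d + 1)) (Fin (d + 1)) K)
    [AddCommGroup V] [Module K V] [Module 𝒜 V] [IsScalarTower K 𝒜 V] [IsSimpleModule 𝒜 V] :
    ∃ w : Fin (d + 1) → V, Submodule.span K (Set.range w) = ⊤ := by
  have : Nontrivial V := IsSimpleModule.nontrivial 𝒜 V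
  obtain ⟨v, hv⟩ := exists_ne (0 : V)
  have hex : ∃ j, g.symm (Matrix.single j j 1) • v ≠ 0 := by
    by_contra! hall
    refine hv ?_
    have h1 : (1 : 𝒜) = ∑ j, g.symm (Matrix.single j j 1) := by
      rw [← map_sum, Matrix.sum_single_one, map_one]
    rw [← one_smul 𝒜 v, h1, Finset.sum_smul]
    exact Finset.sum_eq_zero fun j _ => hall j
  obtain ⟨j, hj⟩ := hex
  refine ⟨fun i => g.symm (Matrix.single i j 1) • v, eq_top_iff.mpr fun x _ => ?_⟩
  obtain ⟨X, rfl⟩ := IsSimpleModule.toSpanSingleton_surjective 𝒜 hj x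
  have hX : X * g.symm (Matrix.single j j 1) = ∑ i, g X i j • g.symm (Matrix.single i j 1) := by
    apply g.injective
    simp only [map_mul, map_sum, map_smul, AlgEquiv.apply_symm_apply]
    ext a b
    simp [Matrix.sum_apply, Matrix.single_apply, Matrix.mul_apply, ite_and]
  rw [LinearMap.toSpanSingleton_apply, smul_smul, hX, Finset.sum_smul]
  refine Submodule.sum_mem _ fun i _ => ?_
  rw [smul_assoc]
  exact Submodule.smul_mem _ _ (Submodule.subset_span ⟨i, rfl⟩)

/-- If `a` acted injectively on the faithful module `V`, left multiplication by `a` would be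
injective, hence surjective by finite dimension, and `a` would be invertible. -/
theorem exists_smul_eq_zero_of_not_isUnit (g : 𝒜 ≃ₐ[K] Matrix (Fin (d + 1)) (Fin (d + 1)) K)
    [AddCommGroup V] [Module K V] [Module 𝒜 V] [IsScalarTower K 𝒜 V] [IsSimpleModule 𝒜 V]
    {a : 𝒜} (ha : ¬ IsUnit a) : ∃ v : V, v ≠ 0 ∧ a • v = 0 := by
  have : Module.Finite K 𝒜 := Module.Finite.equiv g.symm.toLinearEquiv
  by_contra! hinj
  have hl : Function.Injective (LinearMap.mulLeft K a) := by
    rw [injective_iff_map_eq_zero]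
    intro b hb
    refine lsmul_injective (V := V) g (LinearMap.ext fun v => ?_)
    simp only [Algebra.lsmul_coe, map_zero, LinearMap.zero_apply]
    by_contra hne
    refine hinj _ hne ?_
    rw [smul_smul, show a * b = 0 from hb, zero_smul]
  obtain ⟨b, hb⟩ := LinearMap.injective_iff_surjective.mp hl 1
  have hab : g a * g b = 1 := by rw [← map_mul, show a * b = 1 from hb, map_one]
  have hba : b * a = 1 := g.injective (by rw [map_mul, mul_eq_one_comm.mp hab, map_one])
  exact ha ⟨⟨a, b, hb, hba⟩, rfl⟩

theorem IsEigenvalueOrdering.exists_basis (g : 𝒜 ≃ₐ[K] Matrix (Fin (d + 1)) (Fin (d + 1)) K)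
    [AddCommGroup V] [Module K V] [Module 𝒜 V] [IsScalarTower K 𝒜 V] [IsSimpleModule 𝒜 V]
    {A : 𝒜} {θ : Fin (d + 1) → K} (h : IsEigenvalueOrdering A θ) :
    ∃ e : Module.Basis (Fin (d + 1)) K V, ∀ i, Algebra.lsmul K K V A (e i) = θ i • e i := by
  have hev : ∀ i, ∃ v : V, v ≠ 0 ∧ A • v = θ i • v := by
    intro i
    have hi : θ i ∈ spectrum K A := h.range_eq ▸ Set.mem_range_self i
    obtain ⟨v, hv, hv'⟩ := exists_smul_eq_zero_of_not_isUnit (V := V) g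
      (spectrum.mem_iff.mp hi)
    refine ⟨v, hv, ?_⟩
    rw [sub_smul, algebraMap_smul, sub_eq_zero] at hv'
    exact hv'.symm
  choose v hv0 hv using hev
  have hli : LinearIndependent K v :=
    Module.End.eigenvectors_linearIndependent' (Algebra.lsmul K K V A) θ h.injective v fun i =>
      Module.End.hasEigenvector_iff.mpr
        ⟨Module.End.mem_eigenspace_iff.mpr (by simpa using hv i), hv0 i⟩
  obtain ⟨w, hw⟩ := exists_span_range_eq_top (V := V) g
  have : Module.Finite K V := Module.finite_def.mpr (hw ▸ Submodule.fg_span (Set.finite_range w))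
  have hcard : Fintype.card (Fin (d + 1)) = Module.finrank K V := by
    refine le_antisymm hli.fintype_card_le_finrank ?_
    rw [← finrank_top K V, ← hw]
    exact finrank_range_le_card w
  refine ⟨basisOfLinearIndependentOfCardEqFinrank hli hcard, fun i => ?_⟩
  simpa using hv i

theorem primitiveIdempotent_smul [AddCommGroup V] [Module K V] [Module 𝒜 V] [IsScalarTower K 𝒜 V]
    {A : 𝒜} {θ : Fin (d + 1) → K} (hθ : Function.Injective θ)
    {e : Module.Basis (Fin (d + 1)) K V} (he : ∀ i, Algebra.lsmul K K V A (e i) = θ i • e i)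
    (i : Fin (d + 1)) (x : V) : primitiveIdempotent A θ i • x = e.repr x i • e i := by
  change Algebra.lsmul K K V (aeval A _) x = _
  rw [← aeval_algHom_apply]
  refine e.ext_elem fun k => ?_
  rw [repr_aeval he]
  by_cases hk : i = k
  · subst hk
    rw [Lagrange.eval_basis_self hθ.injOn (Finset.mem_univ i)]
    simp
  · rw [Lagrange.eval_basis_of_ne hk (Finset.mem_univ k)]
    simp [hk]

theorem mem_iSup_range_lsmul [AddCommGroup V] [Module K V] [Module 𝒜 V] [IsScalarTower K 𝒜 V]
    {E : Fin (d + 1) → 𝒜} {e : Module.Basis (Fin (d + 1)) K V}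
    (hE : ∀ i x, E i • x = e.repr x i • e i) (P : Fin (d + 1) → Prop) (x : V) :
    x ∈ ⨆ j, ⨆ (_ : P j), LinearMap.range (Algebra.lsmul K K V (E j)) ↔
      ∀ k, ¬ P k → e.repr x k = 0 := by
  constructor
  · intro hx k hk
    have hle : ⨆ j, ⨆ (_ : P j), LinearMap.range (Algebra.lsmul K K V (E j)) ≤
        LinearMap.ker (e.coord k) := by
      refine iSup₂_le fun j hj => ?_
      rintro _ ⟨y, rfl⟩
      have hjk : j ≠ k := fun h => hk (h ▸ hj)
      simp [hE, hjk]
    simpa using hle hx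
  · intro hx
    rw [← e.sum_repr x]
    refine Submodule.sum_mem _ fun k _ => ?_
    by_cases hk : P k
    · exact Submodule.mem_iSup_of_mem k (Submodule.mem_iSup_of_mem hk ⟨x, hE k x⟩)
    · rw [hx k hk, zero_smul]
      exact Submodule.zero_mem _

/-! ### Leonard systems acting on the simple module. -/

namespace LeonardSystem

/-- The relative `(A*; {E* i}; A; {E i})` of the Leonard system `(A; {E i}; A*; {E* i})`. -/
def dual (Φ : LeonardSystem K 𝒜 d) : LeonardSystem K 𝒜 d where
  A := Φ.Astar
  E := Φ.Estar
  Astar := Φ.A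
  Estar := Φ.E
  θ := Φ.θstar
  θstar := Φ.θ
  eigen := Φ.eigen_star
  eigen_star := Φ.eigen
  E_eq := Φ.Estar_eq
  Estar_eq := Φ.E_eq
  E_Astar_E_eq_zero := Φ.Estar_A_Estar_eq_zero
  E_Astar_E_ne_zero := Φ.Estar_A_Estar_ne_zero
  Estar_A_Estar_eq_zero := Φ.E_Astar_E_eq_zero
  Estar_A_Estar_ne_zero := Φ.E_Astar_E_ne_zero

variable [AddCommGroup V] [Module K V] [Module 𝒜 V] [IsScalarTower K 𝒜 V]

/-- `e` and `f` are eigenbases for the two generators of `Φ` in the module `V`. -/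
abbrev HasEigenbases (Φ : LeonardSystem K 𝒜 d) (e f : Module.Basis (Fin (d + 1)) K V) : Prop :=
  EigenbasisPair (Algebra.lsmul K K V Φ.A) (Algebra.lsmul K K V Φ.Astar) e f Φ.θ Φ.θstar

/-- `E i * A* * E j` acts as the `(i, j)` matrix entry of `A*` times a matrix unit; faithfulness
transfers the nonvanishing. -/
theorem tridiagonalOn (Φ : LeonardSystem K 𝒜 d)
    (hinj : Function.Injective (Algebra.lsmul K K V : 𝒜 →ₐ[K] Module.End K V))
    {e : Module.Basis (Fin (d + 1)) K V}
    (he : ∀ i, Algebra.lsmul K K V Φ.A (e i) = Φ.θ i • e i) :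
    TridiagonalOn (Algebra.lsmul K K V Φ.Astar) e := by
  have hE : ∀ i (x : V), Φ.E i • x = e.repr x i • e i := fun i x => by
    rw [Φ.E_eq, primitiveIdempotent_smul Φ.eigen.injective he]
  have hEE : ∀ i j (x : V), (Φ.E i * Φ.Astar * Φ.E j) • x =
      (e.repr x j * e.repr (Algebra.lsmul K K V Φ.Astar (e j)) i) • e i := fun i j x => by
    rw [mul_smul, mul_smul, hE j, hE i, smul_comm, map_smul, Finsupp.smul_apply, smul_eq_mul,
      Algebra.lsmul_coe]
  constructor
  · intro i j hij
    have := hEE i j (e j)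
    rw [Φ.E_Astar_E_eq_zero i j hij, zero_smul] at this
    simpa [e.ne_zero i] using this.symm
  · intro i j hij h0
    refine Φ.E_Astar_E_ne_zero i j hij (hinj (LinearMap.ext fun x => ?_))
    change (Φ.E i * Φ.Astar * Φ.E j) • x = _
    rw [hEE, h0]
    simp

theorem exists_hasEigenbases (g : 𝒜 ≃ₐ[K] Matrix (Fin (d + 1)) (Fin (d + 1)) K)
    [IsSimpleModule 𝒜 V] (Φ : LeonardSystem K 𝒜 d) :
    ∃ e f : Module.Basis (Fin (d + 1)) K V, Φ.HasEigenbases e f := by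
  obtain ⟨e, he⟩ := Φ.eigen.exists_basis (V := V) g
  obtain ⟨f, hf⟩ := Φ.eigen_star.exists_basis (V := V) g
  exact ⟨e, f, Φ.eigen.injective, Φ.eigen_star.injective, he, hf,
    Φ.tridiagonalOn (lsmul_injective g) he, Φ.dual.tridiagonalOn (lsmul_injective g) hf⟩

variable {Φ : LeonardSystem K 𝒜 d} {e f : Module.Basis (Fin (d + 1)) K V}

namespace HasEigenbases

theorem E_smul (h : Φ.HasEigenbases e f) (i : Fin (d + 1)) (x : V) :
    Φ.E i • x = e.repr x i • e i := by
  rw [Φ.E_eq, primitiveIdempotent_smul h.injective h.map_e]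

theorem dual (h : Φ.HasEigenbases e f) : Φ.dual.HasEigenbases f e := EigenbasisPair.swap h

theorem Ddown (h : Φ.HasEigenbases e f) : Φ.Ddown.HasEigenbases (e.reindex Fin.revPerm) f :=
  EigenbasisPair.rev h

theorem mem_splitSpace (h : Φ.HasEigenbases e f) (i : Fin (d + 1)) (x : V) :
    x ∈ Φ.splitSpace V i ↔ InSplit e f i x := by
  have hE' : ∀ j (y : V), Φ.Estar j • y = f.repr y j • f j := h.dual.E_smul
  unfold splitSpace
  rw [Submodule.mem_inf, mem_iSup_range_lsmul hE' (fun j => j ≤ i) x,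
    mem_iSup_range_lsmul h.E_smul (fun j => j ≥ i) x]
  constructor
  · rintro ⟨h1, h2⟩
    exact ⟨fun k hk => h1 k (not_le.mpr hk), fun k hk => h2 k (not_le.mpr hk)⟩
  · rintro ⟨h1, h2⟩
    exact ⟨fun k hk => h1 k (not_le.mp hk), fun k hk => h2 k (not_le.mp hk)⟩

theorem isSplitEigenvalue_iff (h : Φ.HasEigenbases e f) (j : Fin d) (c : K) :
    Φ.IsSplitEigenvalue V j c ↔ IsSplitScalar (Algebra.lsmul K K V Φ.A)
      (Algebra.lsmul K K V Φ.Astar) e f Φ.θ Φ.θstar j c := by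
  have hmap : ∀ x : V, Algebra.lsmul K K V ((Φ.A - algebraMap K 𝒜 (Φ.θ j.castSucc)) *
      (Φ.Astar - algebraMap K 𝒜 (Φ.θstar j.succ))) x =
      (Algebra.lsmul K K V Φ.A - algebraMap K _ (Φ.θ j.castSucc))
        ((Algebra.lsmul K K V Φ.Astar - algebraMap K _ (Φ.θstar j.succ)) x) := fun x => by
    rw [map_mul, map_sub, map_sub, AlgHom.commutes, AlgHom.commutes, Module.End.mul_apply]
  constructor
  · rintro ⟨-, hle⟩ x hx
    have := hle ((h.mem_splitSpace j.succ x).mpr (by simpa using hx))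
    rwa [Module.End.mem_eigenspace_iff, hmap] at this
  · intro hc
    refine ⟨?_, fun x hx => ?_⟩
    · obtain ⟨hw, hw0⟩ := h.aeval_eta_inSplit j.succ
      exact (Submodule.ne_bot_iff _).mpr ⟨_, (h.mem_splitSpace j.succ _).mpr hw, hw0⟩
    · rw [Module.End.mem_eigenspace_iff, hmap]
      exact hc x (by simpa using (h.mem_splitSpace j.succ x).mp hx)

theorem existsUnique_isSplitEigenvalue (h : Φ.HasEigenbases e f) (j : Fin d) :
    ∃! c : K, Φ.IsSplitEigenvalue V j c := by
  simp only [h.isSplitEigenvalue_iff]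
  exact h.existsUnique_isSplitScalar j

/-- Existence of a split eigenvalue makes the `epsilon` choice meaningful. -/
theorem isSplitScalar_firstSplit (h : Φ.HasEigenbases e f) (j : Fin d) :
    IsSplitScalar (Algebra.lsmul K K V Φ.A) (Algebra.lsmul K K V Φ.Astar) e f Φ.θ Φ.θstar j
      (Φ.firstSplit V j) :=
  (h.isSplitEigenvalue_iff j _).mp
    (Classical.epsilon_spec (h.existsUnique_isSplitEigenvalue j).exists)

theorem firstSplit_dual (h : Φ.HasEigenbases e f) : Φ.dual.firstSplit V = Φ.firstSplit V :=
  funext fun j => (h.dual.existsUnique_isSplitScalar j).unique (h.dual.isSplitScalar_firstSplit j)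
    (EigenbasisPair.isSplitScalar_swap h (h.isSplitScalar_firstSplit j))

/-- `tau` of degree `d` vanishes at every eigenvalue but `θ_d`, so normalised it is the idempotent.
-/
theorem E_last_smul (h : Φ.HasEigenbases e f) (x : V) :
    Φ.E (Fin.last d) • x =
      ((tau Φ.θ d).eval (Φ.θ (Fin.last d)))⁻¹ • (aeval Φ.A (tau Φ.θ d) • x) := by
  have h0 := tau_eval_last_ne_zero h.injective
  change _ = _ • (Algebra.lsmul K K V (aeval Φ.A (tau Φ.θ d)) x)
  rw [h.E_smul, ← aeval_algHom_apply]
  refine e.ext_elem fun k => ?_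
  rw [map_smul, map_smul, Finsupp.smul_apply, Finsupp.smul_apply, repr_aeval h.map_e, e.repr_self]
  by_cases hk : k = Fin.last d
  · subst hk
    simp [h0]
  · rw [tau_eval_eq_zero _ (Fin.val_lt_last hk)]
    simp [Ne.symm hk]

theorem E_zero_smul (h : Φ.HasEigenbases e f) (x : V) :
    Φ.E 0 • x = ((eta Φ.θ d).eval (Φ.θ 0))⁻¹ • (aeval Φ.A (eta Φ.θ d) • x) := by
  simpa [LeonardSystem.Ddown, ← eta_eq_tau_rev] using h.Ddown.E_last_smul x

end HasEigenbases

/-! ### The two basic identities and their relatives. -/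

theorem aeval_tau_mul_Estar_zero_mul_E_last (h : Φ.HasEigenbases e f)
    (hinj : Function.Injective (Algebra.lsmul K K V : 𝒜 →ₐ[K] Module.End K V)) {i : ℕ}
    (hi : i ≤ d) :
    aeval Φ.A (tau Φ.θ i) * Φ.Estar 0 * Φ.E (Fin.last d) =
      (prodFirst (Φ.firstSplit V) i / (eta Φ.θstar d).eval (Φ.θstar 0)) •
        (aeval Φ.Astar (eta Φ.θstar (d - i)) * Φ.E (Fin.last d)) := by
  refine hinj (LinearMap.ext fun x => ?_)
  have key := h.aeval_tau_aeval_eta h.isSplitScalar_firstSplit hi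
  rw [aeval_algHom_apply, aeval_algHom_apply, aeval_algHom_apply] at key
  simp only [Algebra.lsmul_coe] at key ⊢
  have hE : ∀ y : V, Φ.Estar 0 • y =
      ((eta Φ.θstar d).eval (Φ.θstar 0))⁻¹ • (aeval Φ.Astar (eta Φ.θstar d) • y) :=
    h.dual.E_zero_smul
  have hcomm : ∀ (a : 𝒜) (c : K) (y : V), a • c • y = c • a • y := fun a c y => smul_comm a c y
  rw [mul_smul, mul_smul, smul_assoc, mul_smul, h.E_smul, hE]
  simp only [hcomm, key, smul_smul]
  congr 1
  ring

theorem aeval_eta_mul_E_last_mul_Estar_zero (h : Φ.HasEigenbases e f)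
    (hinj : Function.Injective (Algebra.lsmul K K V : 𝒜 →ₐ[K] Module.End K V)) {i : ℕ}
    (hi : i ≤ d) :
    aeval Φ.Astar (eta Φ.θstar i) * Φ.E (Fin.last d) * Φ.Estar 0 =
      (prodLast (Φ.firstSplit V) i / (tau Φ.θ d).eval (Φ.θ (Fin.last d))) •
        (aeval Φ.A (tau Φ.θ (d - i)) * Φ.Estar 0) := by
  refine hinj (LinearMap.ext fun x => ?_)
  have key := h.aeval_eta_aeval_tau h.isSplitScalar_firstSplit hi
  rw [aeval_algHom_apply, aeval_algHom_apply, aeval_algHom_apply] at key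
  have hE : Φ.Estar 0 • x = f.repr x 0 • f 0 := h.dual.E_smul 0 x
  simp only [Algebra.lsmul_coe] at key ⊢
  have hcomm : ∀ (a : 𝒜) (c : K) (y : V), a • c • y = c • a • y := fun a c y => smul_comm a c y
  rw [mul_smul, mul_smul, smul_assoc, mul_smul, hE, h.E_last_smul]
  simp only [hcomm, key, smul_smul]
  congr 1
  ring

end LeonardSystem

end MatrixAlgebra

end Leonard

end

theorem theorem5p2 {K 𝒜 V : Type*} [Field K] [Ring 𝒜] [Algebra K 𝒜] (d : ℕ)
    (h𝒜 : Nonempty (𝒜 ≃ₐ[K] Matrix (Fin (d + 1)) (Fin (d + 1)) K))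
    [AddCommGroup V] [Module K V] [Module 𝒜 V] [IsScalarTower K 𝒜 V] [IsSimpleModule 𝒜 V]
    (Φ : Leonard.LeonardSystem K 𝒜 d) :
    -- the split sequences are well defined
    (∀ j : Fin d, (∃! c : K, Φ.IsSplitEigenvalue V j c) ∧
      (∃! c : K, Φ.Ddown.IsSplitEigenvalue V j c)) ∧
    -- the scalars in the denominators are nonzero
    ((Leonard.eta Φ.θstar d).eval (Φ.θstar 0) ≠ 0 ∧
      (Leonard.tau Φ.θstar d).eval (Φ.θstar (Fin.last d)) ≠ 0 ∧
      (Leonard.eta Φ.θ d).eval (Φ.θ 0) ≠ 0 ∧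
      (Leonard.tau Φ.θ d).eval (Φ.θ (Fin.last d)) ≠ 0) ∧
    -- the eight identities
    ∀ i : ℕ, i ≤ d →
      aeval Φ.A (Leonard.eta Φ.θ i) * Φ.Estar 0 * Φ.E 0 =
        (Leonard.prodFirst (Φ.secondSplit V) i /
          (Leonard.eta Φ.θstar d).eval (Φ.θstar 0)) •
            (aeval Φ.Astar (Leonard.eta Φ.θstar (d - i)) * Φ.E 0) ∧
      aeval Φ.A (Leonard.eta Φ.θ i) * Φ.Estar (Fin.last d) * Φ.E 0 =
        (Leonard.prodLast (Φ.firstSplit V) i /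
          (Leonard.tau Φ.θstar d).eval (Φ.θstar (Fin.last d))) •
            (aeval Φ.Astar (Leonard.tau Φ.θstar (d - i)) * Φ.E 0) ∧
      aeval Φ.A (Leonard.tau Φ.θ i) * Φ.Estar 0 * Φ.E (Fin.last d) =
        (Leonard.prodFirst (Φ.firstSplit V) i /
          (Leonard.eta Φ.θstar d).eval (Φ.θstar 0)) •
            (aeval Φ.Astar (Leonard.eta Φ.θstar (d - i)) * Φ.E (Fin.last d)) ∧
      aeval Φ.A (Leonard.tau Φ.θ i) * Φ.Estar (Fin.last d) * Φ.E (Fin.last d) =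
        (Leonard.prodLast (Φ.secondSplit V) i /
          (Leonard.tau Φ.θstar d).eval (Φ.θstar (Fin.last d))) •
            (aeval Φ.Astar (Leonard.tau Φ.θstar (d - i)) * Φ.E (Fin.last d)) ∧
      aeval Φ.Astar (Leonard.eta Φ.θstar i) * Φ.E 0 * Φ.Estar 0 =
        (Leonard.prodLast (Φ.secondSplit V) i /
          (Leonard.eta Φ.θ d).eval (Φ.θ 0)) •
            (aeval Φ.A (Leonard.eta Φ.θ (d - i)) * Φ.Estar 0) ∧
      aeval Φ.Astar (Leonard.eta Φ.θstar i) * Φ.E (Fin.last d) * Φ.Estar 0 =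
        (Leonard.prodLast (Φ.firstSplit V) i /
          (Leonard.tau Φ.θ d).eval (Φ.θ (Fin.last d))) •
            (aeval Φ.A (Leonard.tau Φ.θ (d - i)) * Φ.Estar 0) ∧
      aeval Φ.Astar (Leonard.tau Φ.θstar i) * Φ.E 0 * Φ.Estar (Fin.last d) =
        (Leonard.prodFirst (Φ.firstSplit V) i /
          (Leonard.eta Φ.θ d).eval (Φ.θ 0)) •
            (aeval Φ.A (Leonard.eta Φ.θ (d - i)) * Φ.Estar (Fin.last d)) ∧
      aeval Φ.Astar (Leonard.tau Φ.θstar i) * Φ.E (Fin.last d) * Φ.Estar (Fin.last d) =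
        (Leonard.prodFirst (Φ.secondSplit V) i /
          (Leonard.tau Φ.θ d).eval (Φ.θ (Fin.last d))) •
            (aeval Φ.A (Leonard.tau Φ.θ (d - i)) * Φ.Estar (Fin.last d)) := by
  obtain ⟨g⟩ := h𝒜
  obtain ⟨e, f, h⟩ := Φ.exists_hasEigenbases (V := V) g
  have hinj := Leonard.lsmul_injective (V := V) g
  have hD := h.Ddown
  have hs : Φ.Ddown.firstSplit V = Φ.secondSplit V := rfl
  have first := fun {Ψ : Leonard.LeonardSystem K 𝒜 d} {e f : Module.Basis (Fin (d + 1)) K V}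
    (h : Ψ.HasEigenbases e f) {i : ℕ} (hi : i ≤ d) =>
      Leonard.LeonardSystem.aeval_tau_mul_Estar_zero_mul_E_last h hinj hi
  have last := fun {Ψ : Leonard.LeonardSystem K 𝒜 d} {e f : Module.Basis (Fin (d + 1)) K V}
    (h : Ψ.HasEigenbases e f) {i : ℕ} (hi : i ≤ d) =>
      Leonard.LeonardSystem.aeval_eta_mul_E_last_mul_Estar_zero h hinj hi
  refine ⟨fun j => ⟨h.existsUnique_isSplitEigenvalue j, hD.existsUnique_isSplitEigenvalue j⟩,
    ⟨Leonard.eta_eval_zero_ne_zero h.injective', Leonard.tau_eval_last_ne_zero h.injective',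
      Leonard.eta_eval_zero_ne_zero h.injective, Leonard.tau_eval_last_ne_zero h.injective⟩,
    fun i hi => ⟨?_, ?_, first h hi, ?_, ?_, last h hi, ?_, ?_⟩⟩
  -- Reversing the `E_i` exchanges `tau θ` with `eta θ`, `E_0` with `E_d`, and the two split
  -- sequences.
  · have := first hD hi
    rw [hs] at this
    simpa [Leonard.LeonardSystem.Ddown, ← Leonard.eta_eq_tau_rev] using this
  · have := last h.dual hi
    rwa [h.firstSplit_dual] at this
  -- Reversal followed by exchange; the exchange preserves the split sequence of the reversed
  -- system.
  · have := last hD.dual hi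
    rw [hD.firstSplit_dual, hs] at this
    simpa [Leonard.LeonardSystem.Ddown, Leonard.LeonardSystem.dual, ← Leonard.tau_eq_eta_rev] using this
  · have := last hD hi
    rw [hs] at this
    simpa [Leonard.LeonardSystem.Ddown, ← Leonard.eta_eq_tau_rev] using this
  · have := first h.dual hi
    rwa [h.firstSplit_dual] at this
  · have := first hD.dual hi
    rw [hD.firstSplit_dual, hs] at this
    simpa [Leonard.LeonardSystem.Ddown, Leonard.LeonardSystem.dual, ← Leonard.tau_eq_eta_rev] using this
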